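/- Work in continuous logic in the language $\mathfrak L$ with one sort (a complete metric space $(X,d)$ of diameter $1$), constant symbols $0,1$ and a binary function symbol $+$ satisfying $d(x+y,w+z)\le d(x,w)+d(y,z)$. Formulas are built from the atomic formulas $d(s,t)$ ($s,t$ terms) using continuous connectives $u:[0,1]^k\to[0,1]$, the quantifiers $\sup_x$ and $\inf_x$, and limits of sequences of formulas that converge uniformly over all $\mathfrak L$-structures. A formula is quantifier-free if no $\sup_x$ or $\inf_x$ occurs in its construction. A sentence is a formula without free variables, and $\mathcal M\models\sigma$ means that $\sigma$ has value $\sigma^{\mathcal M}=0$ in $\mathcal M$. An $\forall\exists$ sentence is a prenex sentence $$\sup_{x_1}\cdots\sup_{x_k}\inf_{y_1}\cdots\inf_{y_l}\psi(x_1,\dots,x_k,y_1,\dots,y_l),\qquad k,l\ge 0,$$ with $\psi$ quantifier-free. For a finite set $E$ with at least two elements, the lattice of partitions of $E$, ordered by refinement, is an $\mathfrak L$-structure: $0$ is the partition into singletons, $1$ is the partition with one block, $+$ is the join, and $$d(x,y)=\frac{\#x+\#y-2\,\#(x+y)}{|E|-1},$$ where $\#x$ is the number of blocks of $x$. Write $P_n$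 ($n\ge 2$) for $E=\{1,\dots,n\}$ and $\Pi_n$ ($n\ge1$) for $E=\{0,1,\dots,n\}$. Let $T_{FPL}$ be the set of all sentences $\sigma$ with $\sigma^{P_n}=0$ for all $n\ge 2$. If $m=kn$ with $k,n\geq 1$, let $\varphi_n^{m}:\Pi_n\to\Pi_m$ send $\{B_0,\dots,B_p\}$, where $0\in B_0$, to the partition $\{C_0\}\cup\{C_{ij}:1\le i\le p,\ 0\le j\le k-1\}$ with $C_{ij}=\{kb-j: b\in B_i\}$ and $C_0=\{0,\dots,m\}\setminus\bigcup_{i,j}C_{ij}$. These maps are isometric, preserve $0$, $1$ and $+$, and form a directed system over the positive integers ordered by divisibility. Let $\Pi_{(\infty)}$ be its direct limit, with the induced metric, $0$, $1$ and $+$, and let Björner's continuous partition lattice $\Pi_\infty$ be the metric completion of $\Pi_{(\infty)}$, with $+$ extended continuously. **Proposition.** If $\sigma\in T_{FPL}$ is an $\forall\exists$ sentence, then $\Pi_\infty\models\sigma$. -/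

import Mathlib

open Filter

/-! ## Continuous logic for the language of metric lattices -/

/-- A structure for the language with one sort (a complete metric space of diameter one), two
constant symbols `0` and `1`, and one binary function symbol `+`, interpreted by a contraction
with respect to the `ℓ¹`-metric on pairs. -/
structure MLStructure where
  carrier : Type
  [metricSpace : MetricSpace carrier]
  [completeSpace : CompleteSpace carrier]
  diam_univ : Metric.diam (Set.univ : Set carrier) = 1
  zero : carrier
  one : carrier
  add : carrier → carrier → carrier
  dist_add_add_le : ∀ x y w z : carrier,
    dist (add x y) (add w z) ≤ dist x w + dist y z

attribute [instance] MLStructure.metricSpace MLStructure.completeSpace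

/-- Terms of the language with free variables `x_0, …, x_{n-1}`. -/
inductive MLTerm (n : ℕ) : Type
  | var : Fin n → MLTerm n
  | zero : MLTerm n
  | one : MLTerm n
  | add : MLTerm n → MLTerm n → MLTerm n

/-- Formula expressions with free variables `x_0, …, x_{n-1}`: atomic formulas `d(s, t)`;
continuous connectives `[0,1]^k → [0,1]`; suprema and infima over the last variable; and formal
limits of sequences. A formal limit is a legitimate formula only if the sequence converges
uniformly over all structures; see `MLPreFormula.WellFormed` and `MLFormula` below. -/
inductive MLPreFormula : ℕ → Type
  | dist {n : ℕ} (s t : MLTerm n) : MLPreFormula n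
  | conn {n k : ℕ} (u : C(Fin k → unitInterval, unitInterval)) (φ : Fin k → MLPreFormula n) : MLPreFormula n
  | sup {n : ℕ} (φ : MLPreFormula (n + 1)) : MLPreFormula n
  | inf {n : ℕ} (φ : MLPreFormula (n + 1)) : MLPreFormula n
  | lim {n : ℕ} (φ : ℕ → MLPreFormula n) : MLPreFormula n

namespace MLStructure

theorem dist_le_one (M : MLStructure) (x y : M.carrier) : dist x y ≤ 1 := by
  have hb : Bornology.IsBounded (Set.univ : Set M.carrier) := by
    by_contra h
    have h0 := Metric.diam_eq_zero_of_unbounded h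
    have h1 := M.diam_univ
    rw [h0] at h1
    exact zero_ne_one h1
  have h := Metric.dist_le_diam_of_mem hb (Set.mem_univ x) (Set.mem_univ y)
  rwa [M.diam_univ] at h

/-- The value of a term at a tuple. -/
def termValue (M : MLStructure) {n : ℕ} (v : Fin n → M.carrier) : MLTerm n → M.carrier
  | .var i => v i
  | .zero => M.zero
  | .one => M.one
  | .add s t => M.add (M.termValue v s) (M.termValue v t)

/-- The value in `[0,1]` of a formula expression at a tuple. -/
noncomputable def eval (M : MLStructure) : {n : ℕ} → MLPreFormula n → (Fin n → M.carrier) → unitInterval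
  | _, .dist s t, v =>
      ⟨Dist.dist (M.termValue v s) (M.termValue v t), dist_nonneg, M.dist_le_one _ _⟩
  | _, .conn u φ, v => u fun i => M.eval (φ i) v
  | _, .sup φ, v => ⨆ a : M.carrier, M.eval φ (Fin.snoc v a)
  | _, .inf φ, v => ⨅ a : M.carrier, M.eval φ (Fin.snoc v a)
  | _, .lim φ, v => limUnder atTop fun i => M.eval (φ i) v

end MLStructure

namespace MLPreFormula

/-- Every formal limit occurring in the expression is the limit of a sequence which converges
uniformly over all structures and all tuples. -/
def WellFormed : {n : ℕ} → MLPreFormula n → Prop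
  | _, .dist _ _ => True
  | _, .conn _ φ => ∀ i, WellFormed (φ i)
  | _, .sup φ => WellFormed φ
  | _, .inf φ => WellFormed φ
  | n, .lim φ => (∀ i, WellFormed (φ i)) ∧
      ∀ ε : ℝ, 0 < ε → ∃ N : ℕ, ∀ i ≥ N, ∀ (M : MLStructure) (v : Fin n → M.carrier),
        Dist.dist (M.eval (φ i) v) (M.eval (MLPreFormula.lim φ) v) < ε

/-- No `sup` or `inf` over a variable occurs in the expression. -/
def QuantifierFree : {n : ℕ} → MLPreFormula n → Prop
  | _, .dist _ _ => True
  | _, .conn _ φ => ∀ i, QuantifierFree (φ i)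
  | _, .sup _ => False
  | _, .inf _ => False
  | _, .lim φ => ∀ i, QuantifierFree (φ i)

/-- Expressions `inf_{y_1} ⋯ inf_{y_l} ψ` with `ψ` quantifier-free and `l ≥ 0`. -/
inductive IsExistential : {n : ℕ} → MLPreFormula n → Prop
  | quantifierFree {n : ℕ} {ψ : MLPreFormula n} (h : ψ.QuantifierFree) : IsExistential ψ
  | inf {n : ℕ} {φ : MLPreFormula (n + 1)} (h : IsExistential φ) : IsExistential φ.inf

/-- Expressions `sup_{x_1} ⋯ sup_{x_k} inf_{y_1} ⋯ inf_{y_l} ψ` with `ψ` quantifier-free and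
`k, l ≥ 0`. -/
inductive IsForallExists : {n : ℕ} → MLPreFormula n → Prop
  | existential {n : ℕ} {φ : MLPreFormula n} (h : IsExistential φ) : IsForallExists φ
  | sup {n : ℕ} {φ : MLPreFormula (n + 1)} (h : IsForallExists φ) : IsForallExists φ.sup

end MLPreFormula

/-- Formulas with free variables `x_0, …, x_{n-1}`. -/
def MLFormula (n : ℕ) : Type := {φ : MLPreFormula n // φ.WellFormed}

/-- Sentences: formulas without free variables. -/
abbrev MLSentence : Type := MLFormula 0

/-- The sentence `σ` is a prenex `∀∃` sentence. -/
def MLSentence.IsForallExists (σ : MLSentence) : Prop := σ.1.IsForallExists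

namespace MLStructure

/-- The value `σ^M` of a sentence. -/
noncomputable def value (M : MLStructure) (σ : MLSentence) : unitInterval := M.eval σ.1 Fin.elim0

/-- `M ⊨ σ`: the sentence `σ` has value `0` in `M`. -/
def Satisfies (M : MLStructure) (σ : MLSentence) : Prop := M.value σ = 0

end MLStructure

/-! ## Finite partition lattices -/

/-- The partitions of `E`, as equivalence relations, ordered by refinement. -/
def PartitionLattice (E : Type) : Type := Setoid E

namespace PartitionLattice

instance (E : Type) : CompleteLattice (PartitionLattice E) :=
  inferInstanceAs (CompleteLattice (Setoid E))

variable {E : Type}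

/-- Two elements lie in the same block of `x`. -/
def Rel (x : PartitionLattice E) (a b : E) : Prop := Setoid.r (self := x) a b

/-- The number of blocks. -/
noncomputable def numBlocks (x : PartitionLattice E) : ℕ := Nat.card (Quotient x)

theorem ext {x y : PartitionLattice E} (h : ∀ a b, x.Rel a b ↔ y.Rel a b) : x = y :=
  Setoid.ext h

theorem le_iff {x y : PartitionLattice E} : x ≤ y ↔ ∀ a b, x.Rel a b → y.Rel a b :=
  ⟨fun h _ _ hab => h hab, fun h _ _ hab => h _ _ hab⟩

theorem rel_refl (x : PartitionLattice E) (a : E) : x.Rel a a := Setoid.refl' x a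

theorem rel_symm (x : PartitionLattice E) {a b : E} (h : x.Rel a b) : x.Rel b a :=
  Setoid.symm' x h

theorem rel_trans (x : PartitionLattice E) {a b c : E} (h : x.Rel a b) (h' : x.Rel b c) :
    x.Rel a c := Setoid.trans' x h h'

/-- Functions that are constant on the blocks of `x`. -/
def blockFun (x : PartitionLattice E) : Submodule ℚ (E → ℚ) where
  carrier := {f | ∀ a b, x.Rel a b → f a = f b}
  add_mem' := fun {f g} hf hg a b h => by simp [hf a b h, hg a b h]
  zero_mem' := fun _ _ _ => rfl
  smul_mem' := fun c f hf a b h => by simp [hf a b h]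

theorem blockFun_sup (x y : PartitionLattice E) :
    (x ⊔ y).blockFun = x.blockFun ⊓ y.blockFun := by
  ext f
  constructor
  · intro h
    exact ⟨fun a b hab => h a b (le_iff.1 le_sup_left a b hab),
      fun a b hab => h a b (le_iff.1 le_sup_right a b hab)⟩
  · rintro ⟨h1, h2⟩ a b hab
    have hle : x ⊔ y ≤ (Setoid.ker f : PartitionLattice E) :=
      sup_le (le_iff.2 h1) (le_iff.2 h2)
    exact le_iff.1 hle a b hab

theorem blockFun_anti {x y : PartitionLattice E} (h : x ≤ y) : y.blockFun ≤ x.blockFun :=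
  fun _ hf a b hab => hf a b (le_iff.1 h a b hab)

theorem numBlocks_bot : (⊥ : PartitionLattice E).numBlocks = Nat.card E :=
  Nat.card_congr (Setoid.quotientBotEquiv)

theorem numBlocks_top [Nonempty E] : (⊤ : PartitionLattice E).numBlocks = 1 := by
  have : Subsingleton (Quotient (⊤ : Setoid E)) := Quotient.subsingleton_iff.2 rfl
  have : Nonempty (Quotient (⊤ : Setoid E)) := ⟨Quotient.mk _ (Classical.arbitrary E)⟩
  exact Nat.card_eq_one_iff_unique.2 ⟨‹_›, ‹_›⟩

variable [Finite E]

theorem finrank_blockFun (x : PartitionLattice E) :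
    Module.finrank ℚ x.blockFun = x.numBlocks := by
  classical
  have hfin : Finite (Quotient x) := Quotient.finite x
  let _ : Fintype (Quotient x) := Fintype.ofFinite _
  let e : x.blockFun ≃ₗ[ℚ] (Quotient x → ℚ) :=
    { toFun := fun f q => Quotient.lift (s := x) f.1 (fun a b h => f.2 a b h) q
      invFun := fun g => ⟨fun a => g (Quotient.mk x a), fun a b h => by
        have h' : Quotient.mk x a = Quotient.mk x b := Quotient.sound h
        simp only [h']⟩
      left_inv := fun f => rfl
      right_inv := fun g => by
        funext q
        induction q using Quotient.inductionOn
        rfl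
      map_add' := fun f g => by
        funext q
        induction q using Quotient.inductionOn
        rfl
      map_smul' := fun c f => by
        funext q
        induction q using Quotient.inductionOn
        rfl }
  rw [e.finrank_eq, Module.finrank_fintype_fun_eq_card, numBlocks, Nat.card_eq_fintype_card]

theorem numBlocks_anti {x y : PartitionLattice E} (h : x ≤ y) : y.numBlocks ≤ x.numBlocks := by
  rw [← finrank_blockFun, ← finrank_blockFun]
  exact Submodule.finrank_mono (blockFun_anti h)

theorem numBlocks_submodular (x y z : PartitionLattice E) :
    (x ⊔ y).numBlocks + (y ⊔ z).numBlocks ≤ y.numBlocks + (x ⊔ y ⊔ z).numBlocks := by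
  simp only [← finrank_blockFun]
  have h := Submodule.finrank_sup_add_finrank_inf_eq (x ⊔ y).blockFun (y ⊔ z).blockFun
  have h1 : x ⊔ y ⊔ (y ⊔ z) = x ⊔ y ⊔ z := by rw [← sup_assoc, sup_assoc x y y, sup_idem]
  rw [← blockFun_sup, h1] at h
  have h2 : Module.finrank ℚ ((x ⊔ y).blockFun ⊔ (y ⊔ z).blockFun : Submodule ℚ (E → ℚ)) ≤
      Module.finrank ℚ y.blockFun :=
    Submodule.finrank_mono (sup_le (blockFun_anti le_sup_right) (blockFun_anti le_sup_left))
  omega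

theorem eq_of_le_of_numBlocks {x y : PartitionLattice E} (h : x ≤ y)
    (hn : x.numBlocks = y.numBlocks) : x = y := by
  have h1 : y.blockFun = x.blockFun := by
    apply Submodule.eq_of_le_of_finrank_eq (blockFun_anti h)
    rw [finrank_blockFun, finrank_blockFun, hn]
  refine le_antisymm h (le_iff.2 fun a b hab => ?_)
  classical
  let f : E → ℚ := fun c => if x.Rel a c then 1 else 0
  have hf : f ∈ x.blockFun := by
    intro c d hcd
    have : x.Rel a c ↔ x.Rel a d :=
      ⟨fun h => x.rel_trans h hcd, fun h => x.rel_trans h (x.rel_symm hcd)⟩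
    simp only [f, this]
  rw [← h1] at hf
  have h2 : f a = f b := hf a b hab
  by_contra hc
  simp [f, hc, x.rel_refl a] at h2

theorem card_sub_one_pos [Nontrivial E] : (0 : ℝ) < (Nat.card E : ℝ) - 1 := by
  have h : 1 < Nat.card E := Finite.one_lt_card
  have h' : (1 : ℝ) < Nat.card E := by exact_mod_cast h
  linarith

/-- The metric `d(x, y) = (#x + #y - 2 #(x + y)) / (|E| - 1)`. -/
noncomputable instance [Nontrivial E] : MetricSpace (PartitionLattice E) where
  dist x y := ((x.numBlocks : ℝ) + y.numBlocks - 2 * (x ⊔ y).numBlocks) / ((Nat.card E : ℝ) - 1)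
  dist_self x := by simp; left; ring
  dist_comm x y := by rw [sup_comm]; ring
  dist_triangle x y z := by
    rw [← add_div]
    apply div_le_div_of_nonneg_right _ card_sub_one_pos.le
    have h1 := numBlocks_submodular x y z
    have h2 : (x ⊔ y ⊔ z).numBlocks ≤ (x ⊔ z).numBlocks :=
      numBlocks_anti (sup_le (le_sup_left.trans le_sup_left) le_sup_right)
    have h1' : ((x ⊔ y).numBlocks : ℝ) + (y ⊔ z).numBlocks ≤
        y.numBlocks + (x ⊔ y ⊔ z).numBlocks := by exact_mod_cast h1
    have h2' : ((x ⊔ y ⊔ z).numBlocks : ℝ) ≤ (x ⊔ z).numBlocks := by exact_mod_cast h2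
    linarith
  eq_of_dist_eq_zero {x y} h := by
    have hp := card_sub_one_pos (E := E)
    have h0 : (x.numBlocks : ℝ) + y.numBlocks - 2 * (x ⊔ y).numBlocks = 0 := by
      rcases div_eq_zero_iff.1 h with h | h
      · exact h
      · exact absurd h hp.ne'
    have h1 : x.numBlocks + y.numBlocks = 2 * (x ⊔ y).numBlocks := by
      have : (x.numBlocks : ℝ) + y.numBlocks = 2 * (x ⊔ y).numBlocks := by linarith
      exact_mod_cast this
    have h2 := numBlocks_anti (le_sup_left : x ≤ x ⊔ y)
    have h3 := numBlocks_anti (le_sup_right : y ≤ x ⊔ y)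
    rw [eq_of_le_of_numBlocks (le_sup_left : x ≤ x ⊔ y) (by omega)]
    exact (eq_of_le_of_numBlocks (le_sup_right : y ≤ x ⊔ y) (by omega)).symm

theorem dist_def [Nontrivial E] (x y : PartitionLattice E) :
    dist x y =
      ((x.numBlocks : ℝ) + y.numBlocks - 2 * (x ⊔ y).numBlocks) / ((Nat.card E : ℝ) - 1) := rfl

theorem numBlocks_pos [Nonempty E] (x : PartitionLattice E) : 1 ≤ x.numBlocks := by
  have := numBlocks_anti (le_top : x ≤ ⊤)
  rwa [numBlocks_top] at this

theorem numBlocks_le (x : PartitionLattice E) : x.numBlocks ≤ Nat.card E := by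
  have := numBlocks_anti (bot_le : ⊥ ≤ x)
  rwa [numBlocks_bot] at this

theorem dist_bot_top [Nontrivial E] : dist (⊥ : PartitionLattice E) ⊤ = 1 := by
  rw [dist_def, sup_top_eq, numBlocks_bot, numBlocks_top]
  rw [div_eq_one_iff_eq card_sub_one_pos.ne']
  push_cast
  ring

theorem dist_le_one [Nontrivial E] (x y : PartitionLattice E) : dist x y ≤ 1 := by
  rw [dist_def, div_le_one card_sub_one_pos]
  have h := numBlocks_submodular x ⊥ y
  have h1 := numBlocks_pos (x ⊔ y)
  rw [sup_bot_eq, bot_sup_eq, numBlocks_bot] at h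
  have h' : (x.numBlocks : ℝ) + y.numBlocks ≤ Nat.card E + (x ⊔ y).numBlocks := by
    exact_mod_cast h
  have h1' : (1 : ℝ) ≤ (x ⊔ y).numBlocks := by exact_mod_cast h1
  linarith

theorem dist_sup_sup_le [Nontrivial E] (x y w z : PartitionLattice E) :
    dist (x ⊔ y) (w ⊔ z) ≤ dist x w + dist y z := by
  have key : ∀ a b c : PartitionLattice E, dist (a ⊔ c) (b ⊔ c) ≤ dist a b := by
    intro a b c
    rw [dist_def, dist_def]
    apply div_le_div_of_nonneg_right _ card_sub_one_pos.le
    have h1 := numBlocks_submodular b a c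
    have h2 := numBlocks_submodular a b c
    have e : a ⊔ c ⊔ (b ⊔ c) = a ⊔ b ⊔ c := by
      rw [sup_sup_sup_comm, sup_idem]
    rw [sup_comm b a] at h1
    rw [e]
    have h1' : ((a ⊔ b).numBlocks : ℝ) + (a ⊔ c).numBlocks ≤
        a.numBlocks + (a ⊔ b ⊔ c).numBlocks := by exact_mod_cast h1
    have h2' : ((a ⊔ b).numBlocks : ℝ) + (b ⊔ c).numBlocks ≤
        b.numBlocks + (a ⊔ b ⊔ c).numBlocks := by exact_mod_cast h2
    linarith
  calc dist (x ⊔ y) (w ⊔ z) ≤ dist (x ⊔ y) (w ⊔ y) + dist (w ⊔ y) (w ⊔ z) := dist_triangle _ _ _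
    _ ≤ dist x w + dist y z := by
      refine add_le_add (key _ _ _) ?_
      rw [sup_comm w y, sup_comm w z]
      exact key _ _ _

end PartitionLattice

/-- A metric space with distances at most one, attained, has diameter one. -/
theorem diam_univ_eq_one {X : Type} [MetricSpace X] (h : ∀ x y : X, dist x y ≤ 1) (a b : X)
    (hab : dist a b = 1) : Metric.diam (Set.univ : Set X) = 1 := by
  apply le_antisymm
  · exact Metric.diam_le_of_forall_dist_le zero_le_one fun x _ y _ => h x y
  · rw [← hab]
    refine Metric.dist_le_diam_of_mem ?_ (Set.mem_univ a) (Set.mem_univ b)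
    exact Metric.isBounded_iff.2 ⟨1, fun x _ y _ => h x y⟩

/-- The partition lattice of a finite set with at least two elements, as a structure for the
language of metric lattices: `0` is the partition into singletons, `1` the partition with one
block, and `+` is the join. -/
noncomputable def partitionStructure (E : Type) [Finite E] [Nontrivial E] : MLStructure where
  carrier := PartitionLattice E
  completeSpace := by
    have : Finite (PartitionLattice E) :=
      Finite.of_injective (fun x : PartitionLattice E => x.Rel) fun x y h =>
        PartitionLattice.ext fun a b => by
          have h' : x.Rel = y.Rel := h
          rw [h']
    have : ProperSpace (PartitionLattice E) := inferInstance
    infer_instance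
  diam_univ := diam_univ_eq_one PartitionLattice.dist_le_one ⊥ ⊤ PartitionLattice.dist_bot_top
  zero := (⊥ : PartitionLattice E)
  one := (⊤ : PartitionLattice E)
  add := fun x y : PartitionLattice E => x ⊔ y
  dist_add_add_le := PartitionLattice.dist_sup_sup_le

/-- The theory `T_FPL` of the finite partition lattices `P_n`, `n ≥ 2`: all sentences `σ` with
`σ^{P_n} = 0` for every `n`. (The one-point lattices `P_0` and `P_1` do not have diameter one.) -/
def TFPL : Set MLSentence :=
  {σ | ∀ (n : ℕ) [Nontrivial (Fin n)], (partitionStructure (Fin n)).Satisfies σ}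

/-! ## The maps `φ_n^m` and Björner's continuous partition lattice -/

/-- The lattice `Π_n` of partitions of `{0, 1, …, n}`. -/
abbrev PiLattice (n : ℕ) : Type := PartitionLattice (Fin (n + 1))

namespace PiLattice

/-- For the block `B` of `b` in `x`, the element `c` lies in `{k b' - j | b' ∈ B}`. -/
def InCopy {n m : ℕ} (k : ℕ) (x : PiLattice n) (b : Fin (n + 1)) (j : ℕ) (c : Fin (m + 1)) :
    Prop :=
  ∃ b' : Fin (n + 1), x.Rel b b' ∧ (c : ℕ) + j = k * b'

/-- The element `c` lies in none of the sets `C_{ij} = {k b' - j | b' ∈ B_i}`, where `B_i` runs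
over the blocks of `x` that do not contain `0`, and `0 ≤ j < k`. -/
def InZero {n m : ℕ} (k : ℕ) (x : PiLattice n) (c : Fin (m + 1)) : Prop :=
  ∀ (b : Fin (n + 1)) (j : ℕ), j < k → ¬ x.Rel b 0 → ¬ InCopy k x b j c

theorem exists_copy {n m k : ℕ} (hk : 0 < k) (hm : k * n = m) (c : Fin (m + 1)) :
    ∃ (b : Fin (n + 1)) (j : ℕ), j < k ∧ (c : ℕ) + j = k * b := by
  have hc : (c : ℕ) ≤ k * n := by have := c.2; omega
  have h1 := Nat.div_add_mod (c : ℕ) k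
  have h2 := Nat.mod_lt (c : ℕ) hk
  by_cases h : (c : ℕ) % k = 0
  · refine ⟨⟨c / k, ?_⟩, 0, hk, ?_⟩
    · have : (c : ℕ) / k ≤ n := Nat.div_le_of_le_mul hc
      omega
    · simp only; omega
  · refine ⟨⟨c / k + 1, ?_⟩, k - c % k, by omega, ?_⟩
    · have : (c : ℕ) / k < n := by
        by_contra hn
        have := Nat.mul_le_mul_left k (not_lt.1 hn)
        omega
      omega
    · simp only [mul_add, mul_one]; omega

theorem copy_unique {k b b' j j' : ℕ} (hj : j < k) (hj' : j' < k)
    (h : k * b + j' = k * b' + j) : b = b' ∧ j = j' := by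
  have hk : 0 < k := by omega
  have e1 : (k * b + j') / k = b := by
    rw [Nat.mul_add_div hk, Nat.div_eq_of_lt hj', add_zero]
  have e2 : (k * b' + j) / k = b' := by
    rw [Nat.mul_add_div hk, Nat.div_eq_of_lt hj, add_zero]
  have e : b = b' := by rw [← e1, ← e2, h]
  subst e
  exact ⟨rfl, by omega⟩

theorem inCopy_iff {n m k : ℕ} (x : PiLattice n) {b a : Fin (n + 1)} {i j : ℕ} {c : Fin (m + 1)}
    (hi : i < k) (hj : j < k) (hc : (c : ℕ) + i = k * a) :
    InCopy k x b j c ↔ x.Rel b a ∧ i = j := by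
  constructor
  · rintro ⟨b', hb, h⟩
    have hu := copy_unique (k := k) (b := a) (b' := b') hi hj (by omega)
    have e : a = b' := Fin.ext hu.1
    subst e
    exact ⟨hb, hu.2⟩
  · rintro ⟨hb, rfl⟩
    exact ⟨a, hb, hc⟩

theorem inZero_iff {n m k : ℕ} (x : PiLattice n) {a : Fin (n + 1)} {i : ℕ} {c : Fin (m + 1)}
    (hi : i < k) (hc : (c : ℕ) + i = k * a) : InZero k x c ↔ x.Rel a 0 := by
  constructor
  · intro h
    by_contra ha
    exact h a i hi ha ((inCopy_iff x hi hi hc).2 ⟨x.rel_refl a, rfl⟩)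
  · intro ha b j hj hb h
    exact hb (x.rel_trans ((inCopy_iff x hi hj hc).1 h).1 ha)

/-- Both elements lie in `C_0`, or both lie in the same `C_{ij}`. -/
def PhiRel {n m : ℕ} (k : ℕ) (x : PiLattice n) (c c' : Fin (m + 1)) : Prop :=
  (InZero k x c ∧ InZero k x c') ∨
    ∃ (b : Fin (n + 1)) (j : ℕ), j < k ∧ ¬ x.Rel b 0 ∧ InCopy k x b j c ∧ InCopy k x b j c'

theorem phiRel_iff {n m k : ℕ} (x : PiLattice n) {a a' : Fin (n + 1)} {i i' : ℕ}
    {c c' : Fin (m + 1)} (hi : i < k) (hi' : i' < k) (hc : (c : ℕ) + i = k * a)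
    (hc' : (c' : ℕ) + i' = k * a') :
    PhiRel k x c c' ↔ x.Rel a a' ∧ (x.Rel a 0 ∨ i = i') := by
  unfold PhiRel
  rw [inZero_iff x hi hc, inZero_iff x hi' hc']
  constructor
  · rintro (⟨h, h'⟩ | ⟨b, j, hj, hb, h, h'⟩)
    · exact ⟨x.rel_trans h (x.rel_symm h'), Or.inl h⟩
    · rw [inCopy_iff x hi hj hc] at h
      rw [inCopy_iff x hi' hj hc'] at h'
      exact ⟨x.rel_trans (x.rel_symm h.1) h'.1, Or.inr (h.2.trans h'.2.symm)⟩
  · rintro ⟨h, h'⟩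
    by_cases h0 : x.Rel a 0
    · exact Or.inl ⟨h0, x.rel_trans (x.rel_symm h) h0⟩
    · have e : i = i' := h'.resolve_left h0
      subst e
      exact Or.inr ⟨a, i, hi, h0, (inCopy_iff x hi hi hc).2 ⟨x.rel_refl a, rfl⟩,
        (inCopy_iff x hi hi hc').2 ⟨h, rfl⟩⟩

/-- The map `φ_n^m : Π_n → Π_m` for `m = k n`. If `x = {B_0, …, B_p}` with `0 ∈ B_0`, its value
at `x` consists of the sets `C_{ij} = {k b - j | b ∈ B_i}`, `1 ≤ i ≤ p`, `0 ≤ j < k`, and of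
the complement `C_0` of their union. -/
def phi {n m : ℕ} (k : ℕ) (hk : 0 < k) (hm : k * n = m) (x : PiLattice n) : PiLattice m where
  r := PhiRel k x
  iseqv := by
    refine ⟨fun c => ?_, fun {c c'} h => ?_, fun {c c' c''} h h' => ?_⟩
    · obtain ⟨a, i, hi, hc⟩ := exists_copy hk hm c
      exact (phiRel_iff x hi hi hc hc).2 ⟨x.rel_refl a, Or.inr rfl⟩
    · obtain ⟨a, i, hi, hc⟩ := exists_copy hk hm c
      obtain ⟨a', i', hi', hc'⟩ := exists_copy hk hm c'
      rw [phiRel_iff x hi hi' hc hc'] at h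
      rw [phiRel_iff x hi' hi hc' hc]
      exact ⟨x.rel_symm h.1, h.2.imp (fun h0 => x.rel_trans (x.rel_symm h.1) h0) Eq.symm⟩
    · obtain ⟨a, i, hi, hc⟩ := exists_copy hk hm c
      obtain ⟨a', i', hi', hc'⟩ := exists_copy hk hm c'
      obtain ⟨a'', i'', hi'', hc''⟩ := exists_copy hk hm c''
      rw [phiRel_iff x hi hi' hc hc'] at h
      rw [phiRel_iff x hi' hi'' hc' hc''] at h'
      rw [phiRel_iff x hi hi'' hc hc'']
      refine ⟨x.rel_trans h.1 h'.1, ?_⟩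
      rcases h.2 with h0 | h0
      · exact Or.inl h0
      · rcases h'.2 with h1 | h1
        · exact Or.inl (x.rel_trans h.1 h1)
        · exact Or.inr (h0.trans h1)

theorem phi_rel_iff {n m k : ℕ} (hk : 0 < k) (hm : k * n = m) (x : PiLattice n)
    {a a' : Fin (n + 1)} {i i' : ℕ} {c c' : Fin (m + 1)} (hi : i < k) (hi' : i' < k)
    (hc : (c : ℕ) + i = k * a) (hc' : (c' : ℕ) + i' = k * a') :
    (phi k hk hm x).Rel c c' ↔ x.Rel a a' ∧ (x.Rel a 0 ∨ i = i') :=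
  phiRel_iff x hi hi' hc hc'

theorem phi_one {n m : ℕ} (hm : 1 * n = m) (x : PiLattice n) :
    phi 1 one_pos hm x = (show n = m by omega) ▸ x := by
  obtain rfl : n = m := by omega
  refine PartitionLattice.ext fun a b => ?_
  rw [phi_rel_iff one_pos hm x one_pos one_pos (a := a) (a' := b) (by simp) (by simp)]
  simp

theorem phi_phi {n m l k k' : ℕ} (hk : 0 < k) (hm : k * n = m) (hk' : 0 < k') (hl : k' * m = l)
    (hkk : 0 < k' * k) (hl' : k' * k * n = l) (x : PiLattice n) :
    phi k' hk' hl (phi k hk hm x) = phi (k' * k) hkk hl' x := by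
  refine PartitionLattice.ext fun c c' => ?_
  obtain ⟨b, j, hj, hc⟩ := exists_copy hk' hl c
  obtain ⟨b', j', hj', hc'⟩ := exists_copy hk' hl c'
  obtain ⟨a, i, hi, hb⟩ := exists_copy hk hm b
  obtain ⟨a', i', hi', hb'⟩ := exists_copy hk hm b'
  have bound : ∀ {i j : ℕ}, i < k → j < k' → k' * i + j < k' * k := by
    intro i j hi hj
    have := Nat.mul_le_mul_left k' (Nat.succ_le_of_lt hi)
    rw [Nat.mul_succ] at this
    omega
  have e1 : (c : ℕ) + (k' * i + j) = k' * k * a := by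
    rw [mul_assoc, ← hb, mul_add, ← hc]; ring
  have e2 : (c' : ℕ) + (k' * i' + j') = k' * k * a' := by
    rw [mul_assoc, ← hb', mul_add, ← hc']; ring
  rw [phi_rel_iff hk' hl _ hj hj' hc hc', phi_rel_iff hk hm x hi hi' hb hb',
    phi_rel_iff hk hm x hi hk hb (a' := 0) (i' := 0) (by simp),
    phi_rel_iff hkk hl' x (bound hi hj) (bound hi' hj') e1 e2]
  have e3 : k' * i + j = k' * i' + j' ↔ i = i' ∧ j = j' :=
    ⟨fun h => by
      have := copy_unique (k := k') (b := i) (b' := i') hj' hj h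
      exact ⟨this.1, this.2.symm⟩, fun h => by rw [h.1, h.2]⟩
  rw [e3]
  constructor
  · rintro ⟨⟨h1, h2⟩, h3⟩
    refine ⟨h1, ?_⟩
    rcases h2 with h2 | h2
    · exact Or.inl h2
    · rcases h3 with h3 | h3
      · exact Or.inl h3.1
      · exact Or.inr ⟨h2, h3⟩
  · rintro ⟨h1, h2 | ⟨h2, h3⟩⟩
    · exact ⟨⟨h1, Or.inl h2⟩, Or.inl ⟨h2, Or.inl h2⟩⟩
    · exact ⟨⟨h1, Or.inr h2⟩, Or.inr h3⟩

theorem phi_mono {n m k : ℕ} (hk : 0 < k) (hm : k * n = m) {x y : PiLattice n} (h : x ≤ y) :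
    phi k hk hm x ≤ phi k hk hm y := by
  rw [PartitionLattice.le_iff] at h ⊢
  intro c c' hcc
  obtain ⟨a, i, hi, hc⟩ := exists_copy hk hm c
  obtain ⟨a', i', hi', hc'⟩ := exists_copy hk hm c'
  rw [phi_rel_iff hk hm _ hi hi' hc hc'] at hcc ⊢
  exact ⟨h _ _ hcc.1, hcc.2.imp_left (h _ _)⟩

theorem phi_sup {n m k : ℕ} (hk : 0 < k) (hm : k * n = m) (x y : PiLattice n) :
    phi k hk hm (x ⊔ y) = phi k hk hm x ⊔ phi k hk hm y := by
  apply le_antisymm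
  · let p : ℕ → Fin (n + 1) → Fin (m + 1) := fun j b => ⟨k * b - j, by
      have h1 := Nat.mul_le_mul_left k (Nat.lt_succ_iff.1 b.2)
      omega⟩
    have hp0 : ∀ j, p j 0 = 0 := fun j => Fin.ext (by simp [p])
    have hpp : ∀ {j : ℕ} {b : Fin (n + 1)}, j < k → b ≠ 0 → (p j b : ℕ) + j = k * b := by
      intro j b hj hb
      have h1 : 1 ≤ (b : ℕ) := Nat.one_le_iff_ne_zero.2 fun h => hb (Fin.ext h)
      have h2 := Nat.mul_le_mul_left k h1
      simp only [p]
      omega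
    have key : ∀ (z : PiLattice n) (j : ℕ), j < k → ∀ b b', z.Rel b b' →
        (phi k hk hm z).Rel (p j b) (p j b') := by
      intro z j hj b b' hbb
      by_cases hb : b = 0
      · subst hb
        by_cases hb' : b' = 0
        · subst hb'
          exact PartitionLattice.rel_refl _ _
        · rw [hp0, phi_rel_iff hk hm z hk hj (a := 0) (by simp) (hpp hj hb')]
          exact ⟨hbb, Or.inl (z.rel_refl 0)⟩
      · by_cases hb' : b' = 0
        · subst hb'
          rw [hp0, phi_rel_iff hk hm z hj hk (a' := 0) (hpp hj hb) (by simp)]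
          exact ⟨hbb, Or.inl hbb⟩
        · rw [phi_rel_iff hk hm z hj hj (hpp hj hb) (hpp hj hb')]
          exact ⟨hbb, Or.inr rfl⟩
    have key2 : ∀ j, j < k → ∀ b b', (x ⊔ y).Rel b b' →
        (phi k hk hm x ⊔ phi k hk hm y).Rel (p j b) (p j b') := by
      intro j hj
      have hle : x ⊔ y ≤
          (Setoid.comap (p j) (phi k hk hm x ⊔ phi k hk hm y) : PiLattice n) :=
        sup_le
          (PartitionLattice.le_iff.2 fun b b' h =>
            PartitionLattice.le_iff.1 le_sup_left _ _ (key x j hj b b' h))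
          (PartitionLattice.le_iff.2 fun b b' h =>
            PartitionLattice.le_iff.1 le_sup_right _ _ (key y j hj b b' h))
      exact PartitionLattice.le_iff.1 hle
    have hpc : ∀ {c : Fin (m + 1)} {i : ℕ} {a : Fin (n + 1)}, (c : ℕ) + i = k * a → c = p i a := by
      intro c i a h
      apply Fin.ext
      simp only [p]
      omega
    rw [PartitionLattice.le_iff]
    intro c c' hcc
    obtain ⟨a, i, hi, hc⟩ := exists_copy hk hm c
    obtain ⟨a', i', hi', hc'⟩ := exists_copy hk hm c'
    rw [phi_rel_iff hk hm _ hi hi' hc hc'] at hcc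
    rw [hpc hc, hpc hc']
    rcases hcc with ⟨h1, h2 | rfl⟩
    · have e1 := key2 i hi _ _ h2
      have e2 := key2 i' hi' _ _ (PartitionLattice.rel_trans _ (PartitionLattice.rel_symm _ h1) h2)
      rw [hp0] at e1 e2
      exact PartitionLattice.rel_trans _ e1 (PartitionLattice.rel_symm _ e2)
    · exact key2 i hi _ _ h1
  · exact sup_le (phi_mono hk hm le_sup_left) (phi_mono hk hm le_sup_right)

theorem numBlocks_phi {n m k : ℕ} (hk : 0 < k) (hm : k * n = m) (x : PiLattice n) :
    (phi k hk hm x).numBlocks + k = k * x.numBlocks + 1 := by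
  classical
  let q0 : Quotient x := Quotient.mk x 0
  let g : Fin (n + 1) → ℕ → Option ({q : Quotient x // q ≠ q0} × ℕ) := fun b j =>
    if h : Quotient.mk x b = q0 then none else some (⟨Quotient.mk x b, h⟩, j)
  choose a i hi hc using exists_copy (n := n) hk hm
  let f : Fin (m + 1) → Option ({q : Quotient x // q ≠ q0} × Fin k) := fun c =>
    if h : Quotient.mk x (a c) = q0 then none else some (⟨Quotient.mk x (a c), h⟩, ⟨i c, hi c⟩)
  have hq : ∀ b b', Quotient.mk x b = Quotient.mk x b' ↔ x.Rel b b' := fun b b' =>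
    ⟨fun h => Quotient.exact h, fun h => Quotient.sound h⟩
  have hker : phi k hk hm x = (Setoid.ker f : PiLattice m) := by
    refine PartitionLattice.ext fun c c' => ?_
    rw [phi_rel_iff hk hm x (hi c) (hi c') (hc c) (hc c')]
    change _ ↔ f c = f c'
    simp only [f, q0]
    by_cases h : x.Rel (a c) 0 <;> by_cases h' : x.Rel (a c') 0
    · simp [hq, h, h', x.rel_trans h (x.rel_symm h')]
    · have : ¬ x.Rel (a c) (a c') := fun e => h' (x.rel_trans (x.rel_symm e) h)
      simp [hq, h, h', this]
    · have : ¬ x.Rel (a c) (a c') := fun e => h (x.rel_trans e h')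
      simp [hq, h, h', this]
    · simp [hq, h, h']
  have hsurj : Function.Surjective f := by
    rintro (_ | ⟨⟨q, hqq⟩, j⟩)
    · refine ⟨0, ?_⟩
      have e := copy_unique (k := k) (b := a 0) (b' := 0) (hi 0) hk
        (by have := hc 0; simp only [Fin.val_zero] at this; omega)
      have e' : a 0 = 0 := Fin.ext e.1
      simp [f, e', q0]
    · induction q using Quotient.inductionOn with
      | h b =>
        have hb : b ≠ 0 := fun h => hqq (by rw [h])
        have h1 : 1 ≤ (b : ℕ) := Nat.one_le_iff_ne_zero.2 fun h => hb (Fin.ext h)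
        have h2 := Nat.mul_le_mul_left k h1
        have h3 := Nat.mul_le_mul_left k (Nat.lt_succ_iff.1 b.2)
        have hj := j.2
        let c : Fin (m + 1) := ⟨k * b - j, by omega⟩
        refine ⟨c, ?_⟩
        have hcv : (c : ℕ) = k * b - j := rfl
        have e := copy_unique (k := k) (b := a c) (b' := b) (hi c) hj
          (by have := hc c; omega)
        have e1 : a c = b := Fin.ext e.1
        have e2 : (⟨i c, hi c⟩ : Fin k) = j := Fin.ext e.2
        simp only [f, e1, e2]
        rw [dif_neg hqq]
  have hfin : Finite (Quotient x) := Quotient.finite x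
  let _ : Fintype (Quotient x) := Fintype.ofFinite _
  have h1 : (phi k hk hm x).numBlocks =
      Nat.card (Option ({q : Quotient x // q ≠ q0} × Fin k)) := by
    rw [hker]
    exact Nat.card_congr (Setoid.quotientKerEquivOfSurjective f hsurj)
  have h2 : Nat.card {q : Quotient x // q ≠ q0} + 1 = x.numBlocks := by
    have := Fintype.card_subtype_compl (fun q : Quotient x => q = q0)
    have hpos : 0 < Fintype.card (Quotient x) := Fintype.card_pos_iff.2 ⟨q0⟩
    rw [Fintype.card_subtype_eq] at this
    unfold PartitionLattice.numBlocks
    rw [Nat.card_eq_fintype_card, Nat.card_eq_fintype_card]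
    change Fintype.card {q : Quotient x // ¬ q = q0} + 1 = _
    omega
  rw [h1, Finite.card_option, Nat.card_prod, Nat.card_fin, ← h2]
  ring

end PiLattice

/-- Positive integers, ordered by divisibility. -/
structure DivIndex : Type where
  val : ℕ
  pos : 0 < val

namespace DivIndex

instance : Preorder DivIndex where
  le n m := n.val ∣ m.val
  le_refl n := dvd_refl n.val
  le_trans _ _ _ h h' := Nat.dvd_trans h h'

instance : IsDirectedOrder DivIndex :=
  ⟨fun n m => ⟨⟨n.val * m.val, Nat.mul_pos n.pos m.pos⟩, ⟨m.val, rfl⟩, ⟨n.val, mul_comm _ _⟩⟩⟩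

instance : Nonempty DivIndex := ⟨⟨1, one_pos⟩⟩

instance (n : DivIndex) : Nontrivial (Fin (n.val + 1)) :=
  Fin.nontrivial_iff_two_le.2 (by have := n.pos; omega)

theorem quot_pos {n m : DivIndex} (h : n ≤ m) : 0 < m.val / n.val :=
  Nat.div_pos (Nat.le_of_dvd m.pos h) n.pos

theorem quot_mul {n m : DivIndex} (h : n ≤ m) : m.val / n.val * n.val = m.val :=
  Nat.div_mul_cancel h

end DivIndex

/-- The map `φ_n^m : Π_n → Π_m` for `n ∣ m`, as a join homomorphism. -/
def phiHom (n m : DivIndex) (h : n ≤ m) : SupHom (PiLattice n.val) (PiLattice m.val) where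
  toFun := PiLattice.phi (m.val / n.val) (DivIndex.quot_pos h) (DivIndex.quot_mul h)
  map_sup' := PiLattice.phi_sup _ _

theorem phi_congr {n m k k' : ℕ} (e : k = k') (hk : 0 < k) (hk' : 0 < k') (hm : k * n = m)
    (hm' : k' * n = m) (x : PiLattice n) : PiLattice.phi k hk hm x = PiLattice.phi k' hk' hm' x := by
  subst e
  rfl

instance : DirectedSystem (fun n : DivIndex => PiLattice n.val) (phiHom · · ·) where
  map_self n x := by
    have e : n.val / n.val = 1 := Nat.div_self n.pos
    exact (phi_congr e (DivIndex.quot_pos le_rfl) one_pos (DivIndex.quot_mul le_rfl) (one_mul _)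
      x).trans (PiLattice.phi_one (one_mul _) x)
  map_map l m n h h' x := by
    have e : l.val / m.val * (m.val / n.val) = l.val / n.val :=
      by
        obtain ⟨a, ha⟩ := h
        obtain ⟨b, hb⟩ := h'
        have hn := n.pos
        have hm := m.pos
        rw [hb, Nat.mul_div_cancel_left _ hm, ha, Nat.mul_div_cancel_left _ hn, mul_assoc,
          Nat.mul_div_cancel_left _ hn, mul_comm]
    have hp : 0 < l.val / m.val * (m.val / n.val) :=
      Nat.mul_pos (DivIndex.quot_pos h') (DivIndex.quot_pos h)
    have hq : l.val / m.val * (m.val / n.val) * n.val = l.val := by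
      rw [e]; exact DivIndex.quot_mul (h.trans h')
    exact (PiLattice.phi_phi (DivIndex.quot_pos h) (DivIndex.quot_mul h) (DivIndex.quot_pos h')
      (DivIndex.quot_mul h') hp hq x).trans
      (phi_congr e hp (DivIndex.quot_pos (h.trans h')) hq (DivIndex.quot_mul (h.trans h')) x)

theorem phiHom_sup (n m : DivIndex) (h : n ≤ m) (x y : PiLattice n.val) :
    phiHom n m h (x ⊔ y) = phiHom n m h x ⊔ phiHom n m h y :=
  PiLattice.phi_sup (DivIndex.quot_pos h) (DivIndex.quot_mul h) x y

theorem dist_phiHom (n m : DivIndex) (h : n ≤ m) (x y : PiLattice n.val) :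
    dist (phiHom n m h x) (phiHom n m h y) = dist x y := by
  have hk := DivIndex.quot_pos h
  have hm := DivIndex.quot_mul h
  have cardeq : ∀ l : ℕ, (Nat.card (Fin (l + 1)) : ℝ) - 1 = l := by intro l; simp
  rw [PartitionLattice.dist_def, PartitionLattice.dist_def, ← phiHom_sup, cardeq, cardeq]
  have key : ∀ z : PiLattice n.val, ((phiHom n m h z).numBlocks : ℝ) =
      ((m.val / n.val : ℕ) : ℝ) * z.numBlocks + 1 - ((m.val / n.val : ℕ) : ℝ) := by
    intro z
    have h1 : (phiHom n m h z).numBlocks + m.val / n.val =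
        m.val / n.val * z.numBlocks + 1 := PiLattice.numBlocks_phi hk hm z
    have h2 : ((phiHom n m h z).numBlocks : ℝ) + ((m.val / n.val : ℕ) : ℝ) =
        ((m.val / n.val : ℕ) : ℝ) * z.numBlocks + 1 := by exact_mod_cast h1
    linarith
  have hm' : (m.val : ℝ) = ((m.val / n.val : ℕ) : ℝ) * n.val := by exact_mod_cast hm.symm
  have hk' : ((m.val / n.val : ℕ) : ℝ) ≠ 0 := by exact_mod_cast hk.ne'
  rw [key, key, key, hm', ← mul_div_mul_left _ (n.val : ℝ) hk']
  congr 1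
  ring

/-- The direct limit `Π_(∞)` of the lattices `Π_n`, `n ≥ 1`, under the maps `φ_n^m`, `n ∣ m`. -/
abbrev PiLimit : Type := DirectLimit (fun n : DivIndex => PiLattice n.val) phiHom

namespace PiLimit

/-- The canonical map `Π_n → Π_(∞)`. -/
def of (n : DivIndex) (x : PiLattice n.val) : PiLimit := Quotient.mk _ ⟨n, x⟩

/-- The metric on `Π_(∞)` extending the metrics of the `Π_n`. -/
noncomputable instance : Dist PiLimit :=
  ⟨DirectLimit.lift₂ phiHom phiHom (fun _ x y => dist x y)
    fun n m h x y => (dist_phiHom n m h x y).symm⟩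

/-- The join on `Π_(∞)` extending the joins of the `Π_n`. -/
noncomputable def join : PiLimit → PiLimit → PiLimit :=
  DirectLimit.map₂ phiHom phiHom phiHom (fun _ x y => x ⊔ y) phiHom_sup

theorem dist_of (n : DivIndex) (x y : PiLattice n.val) : dist (of n x) (of n y) = dist x y :=
  DirectLimit.lift₂_def phiHom phiHom _ _ n x y

theorem join_of (n : DivIndex) (x y : PiLattice n.val) :
    join (of n x) (of n y) = of n (x ⊔ y) :=
  DirectLimit.map₂_def phiHom phiHom phiHom (fun _ x y => x ⊔ y) phiHom_sup n x y

theorem exists_of₂ (z w : PiLimit) : ∃ n x y, z = of n x ∧ w = of n y :=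
  DirectLimit.exists_eq_mk₂ phiHom z w

theorem exists_of₃ (z w u : PiLimit) : ∃ n x y v, z = of n x ∧ w = of n y ∧ u = of n v :=
  DirectLimit.exists_eq_mk₃ phiHom z w u

noncomputable instance : MetricSpace PiLimit where
  dist_self z := by
    obtain ⟨n, x, _, rfl, _⟩ := exists_of₂ z z
    rw [dist_of, dist_self]
  dist_comm z w := by
    obtain ⟨n, x, y, rfl, rfl⟩ := exists_of₂ z w
    rw [dist_of, dist_of, dist_comm]
  dist_triangle z w u := by
    obtain ⟨n, x, y, v, rfl, rfl, rfl⟩ := exists_of₃ z w u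
    rw [dist_of, dist_of, dist_of]
    exact dist_triangle x y v
  eq_of_dist_eq_zero {z w} h := by
    obtain ⟨n, x, y, rfl, rfl⟩ := exists_of₂ z w
    rw [dist_of] at h
    rw [eq_of_dist_eq_zero h]

theorem dist_le_one (z w : PiLimit) : dist z w ≤ 1 := by
  obtain ⟨n, x, y, rfl, rfl⟩ := exists_of₂ z w
  exact (dist_of n x y).trans_le (PartitionLattice.dist_le_one x y)

theorem dist_join_join_le (z w z' w' : PiLimit) :
    dist (join z w) (join z' w') ≤ dist z z' + dist w w' := by
  have key : ∀ a b c : PiLimit, dist (join a c) (join b c) ≤ dist a b := by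
    intro a b c
    obtain ⟨n, x, y, v, rfl, rfl, rfl⟩ := exists_of₃ a b c
    rw [join_of, join_of, dist_of, dist_of]
    simpa using PartitionLattice.dist_sup_sup_le x v y v
  have comm : ∀ a b : PiLimit, join a b = join b a := by
    intro a b
    obtain ⟨n, x, y, rfl, rfl⟩ := exists_of₂ a b
    rw [join_of, join_of, sup_comm]
  calc dist (join z w) (join z' w')
      ≤ dist (join z w) (join z' w) + dist (join z' w) (join z' w') := dist_triangle _ _ _
    _ ≤ dist z z' + dist w w' := by
      refine add_le_add (key _ _ _) ?_
      rw [comm z' w, comm z' w']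
      exact key _ _ _

theorem uniformContinuous_join : UniformContinuous₂ join := by
  rw [UniformContinuous₂, Metric.uniformContinuous_iff]
  intro ε hε
  refine ⟨ε / 2, half_pos hε, fun {a b} h => ?_⟩
  have h1 : dist a.1 b.1 < ε / 2 := (le_max_left _ _).trans_lt h
  have h2 : dist a.2 b.2 < ε / 2 := (le_max_right _ _).trans_lt h
  have := dist_join_join_le a.1 a.2 b.1 b.2
  exact this.trans_lt (by linarith)

/-- The least partition `0`, taken at level `1`. -/
def zero : PiLimit := of ⟨1, one_pos⟩ ⊥

/-- The greatest partition `1`, taken at level `1`. -/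
def one : PiLimit := of ⟨1, one_pos⟩ ⊤

end PiLimit

open UniformSpace in
/-- The metric completion `Π_∞` of the direct limit `Π_(∞)`, as a structure for the language of
metric lattices; the join is the continuous extension of the join of `Π_(∞)`. -/
noncomputable def PiInfinity : MLStructure where
  carrier := Completion PiLimit
  diam_univ := by
    refine diam_univ_eq_one (fun x y => ?_) (PiLimit.zero : Completion PiLimit)
      (PiLimit.one : Completion PiLimit) ?_
    · induction x, y using Completion.induction_on₂ with
      | hp => exact isClosed_le (by fun_prop) continuous_const
      | ih z w => rw [Completion.dist_eq]; exact PiLimit.dist_le_one z w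
    · rw [Completion.dist_eq]
      exact (PiLimit.dist_of _ _ _).trans PartitionLattice.dist_bot_top
  zero := (PiLimit.zero : Completion PiLimit)
  one := (PiLimit.one : Completion PiLimit)
  add := Completion.map₂ PiLimit.join
  dist_add_add_le := by
    intro x y w z
    have hc : ∀ {X : Type} [TopologicalSpace X] {f g : X → Completion PiLimit},
        Continuous f → Continuous g → Continuous fun p => Completion.map₂ PiLimit.join (f p) (g p) :=
      fun hf hg => Completion.continuous_map₂ hf hg
    induction x, y using Completion.induction_on₂ with
    | hp =>
      exact isClosed_le ((hc continuous_fst continuous_snd).dist continuous_const) (by fun_prop)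
    | ih a b =>
      induction w, z using Completion.induction_on₂ with
      | hp =>
        exact isClosed_le (continuous_const.dist (hc continuous_fst continuous_snd)) (by fun_prop)
      | ih c d =>
        rw [Completion.map₂_coe_coe _ _ _ PiLimit.uniformContinuous_join,
          Completion.map₂_coe_coe _ _ _ PiLimit.uniformContinuous_join,
          Completion.dist_eq, Completion.dist_eq, Completion.dist_eq]
        exact PiLimit.dist_join_join_le a b c d

/-! An `∀∃` sentence that vanishes in every member of a directed family of structures also vanishes
in the completion of their union. Here the family consists of the lattices Π_n, and Π_n is the
partition lattice on n + 1 points, so every sentence of `TFPL` vanishes in it.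

Let ψ be the quantifier-free matrix. Its values do not change under isometric embeddings
(`Embedding.eval_map`), and it is uniformly continuous on Π_∞ (`uniformContinuous_eval`); formal
limits cause no trouble because well-formedness makes them uniform. Given a tuple x in Π_∞ and ε >
0, take δ from the modulus of ψ and move x by less than δ to a tuple x' in a single Π_n. As Π_n is
finite, the infimum over y is attained there at some y', and ψ(x', y') = 0 since the sentence
vanishes in Π_n. The same witness gives ψ(x, y') ≤ ε in Π_∞, and ε is arbitrary. This is
`eval_le_of_isExistential` followed by `eval_eq_zero_of_isForallExists`.

About partition lattices this uses only that the φ_n^m preserve metric, join, 0 and 1, and that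
every finite tuple of Π_∞ is approximated inside one Π_n (`exists_dist_piEmbedding_lt`), by
directedness of divisibility. -/

namespace MLStructure

/-! ### Transfer of `∀∃` formulas along dense families of embeddings -/

/-- Isometric embeddings of structures. -/
structure Embedding (M N : MLStructure) where
  toFun : M.carrier → N.carrier
  dist_map : ∀ x y, dist (toFun x) (toFun y) = dist x y
  map_zero : toFun M.zero = N.zero
  map_one : toFun M.one = N.one
  map_add : ∀ x y, toFun (M.add x y) = N.add (toFun x) (toFun y)

theorem Embedding.termValue_map {M N : MLStructure} (f : Embedding M N) {n : ℕ}
    (v : Fin n → M.carrier) (t : MLTerm n) :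
    N.termValue (f.toFun ∘ v) t = f.toFun (M.termValue v t) := by
  induction t with
  | var i => rfl
  | zero => exact f.map_zero.symm
  | one => exact f.map_one.symm
  | add s t hs ht => simp only [termValue, hs, ht, f.map_add]

/-- Quantifier-free formulas are preserved by embeddings. -/
theorem Embedding.eval_map {M N : MLStructure} (f : Embedding M N) {n : ℕ}
    {φ : MLPreFormula n} (h : φ.QuantifierFree) (v : Fin n → M.carrier) :
    N.eval φ (f.toFun ∘ v) = M.eval φ v := by
  induction φ with
  | dist s t => simp only [eval, f.termValue_map, f.dist_map]
  | conn u φ ih =>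
    rw [MLPreFormula.QuantifierFree] at h
    simp only [eval]
    congr 1
    funext i
    exact ih i (h i) v
  | sup φ => rw [MLPreFormula.QuantifierFree] at h; exact h.elim
  | inf φ => rw [MLPreFormula.QuantifierFree] at h; exact h.elim
  | lim φ ih =>
    rw [MLPreFormula.QuantifierFree] at h
    simp only [eval]
    -- The two sequences of values agree term by term, so `limUnder` returns the same point even if
    -- they diverge; well-formedness is not needed.
    congr 1
    funext i
    exact ih i (h i) v

theorem uniformContinuous_termValue (M : MLStructure) {n : ℕ} (t : MLTerm n) :
    UniformContinuous fun v : Fin n → M.carrier => M.termValue v t := by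
  induction t with
  | var i => exact Pi.uniformContinuous_proj _ i
  | zero => exact uniformContinuous_const
  | one => exact uniformContinuous_const
  | add s t hs ht =>
    rw [Metric.uniformContinuous_iff] at hs ht ⊢
    intro ε hε
    obtain ⟨δ, hδ, h⟩ := hs (ε / 2) (half_pos hε)
    obtain ⟨δ', hδ', h'⟩ := ht (ε / 2) (half_pos hε)
    refine ⟨min δ δ', lt_min hδ hδ', fun {v w} hvw => ?_⟩
    have h1 := h (hvw.trans_le (min_le_left _ _))
    have h2 := h' (hvw.trans_le (min_le_right _ _))
    exact (M.dist_add_add_le _ _ _ _).trans_lt (by linarith)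

/-- Well-formed quantifier-free formulas are uniformly continuous. -/
theorem uniformContinuous_eval (M : MLStructure) {n : ℕ} {φ : MLPreFormula n}
    (h : φ.QuantifierFree) (hw : φ.WellFormed) :
    UniformContinuous fun v : Fin n → M.carrier => M.eval φ v := by
  induction φ with
  | dist s t =>
    simp only [eval]
    exact ((M.uniformContinuous_termValue s).dist
      (M.uniformContinuous_termValue t)).subtype_mk _
  | conn u φ ih =>
    rw [MLPreFormula.QuantifierFree] at h
    rw [MLPreFormula.WellFormed] at hw
    simp only [eval]
    -- A connective is continuous on a compact cube, hence uniformly continuous (Heine–Cantor).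
    exact (CompactSpace.uniformContinuous_of_continuous u.continuous).comp
      (uniformContinuous_pi.2 fun i => ih i (h i) (hw i))
  | sup φ => rw [MLPreFormula.QuantifierFree] at h; exact h.elim
  | inf φ => rw [MLPreFormula.QuantifierFree] at h; exact h.elim
  | lim φ ih =>
    rw [MLPreFormula.QuantifierFree] at h
    rw [MLPreFormula.WellFormed] at hw
    -- Well-formedness gives convergence uniform over all structures; uniformity over the tuples of
    -- this one `M` suffices, since uniform limits preserve uniform continuity.
    have hlim : TendstoUniformly (fun i v => M.eval (φ i) v)
        (fun v => M.eval (MLPreFormula.lim φ) v) atTop := by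
      rw [Metric.tendstoUniformly_iff]
      intro ε hε
      obtain ⟨N, hN⟩ := hw.2 ε hε
      filter_upwards [eventually_ge_atTop N] with i hi v
      rw [dist_comm]
      exact hN i hi M v
    exact hlim.uniformContinuous (Frequently.of_forall fun i => ih i (h i) (hw.1 i))

/-- Tuples carry the sup metric, so a shared last coordinate costs nothing. This lets the same δ
serve through all the infima of a prefix. -/
theorem dist_snoc_lt {X : Type} [PseudoMetricSpace X] {n : ℕ} {v w : Fin n → X} (a : X) {δ : ℝ}
    (hδ : 0 < δ) (h : dist v w < δ) :
    dist (Fin.snoc v a : Fin (n + 1) → X) (Fin.snoc w a) < δ := by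
  rw [dist_pi_lt_iff hδ]
  intro i
  refine Fin.lastCases ?_ (fun j => ?_) i
  · simpa using hδ
  · simpa using (dist_pi_lt_iff hδ).1 h j

/-- The value of an existential formula in a structure is at most, up to a uniform error, its
value at a nearby tuple in a finite substructure. -/
theorem eval_le_of_isExistential (N : MLStructure) {n : ℕ} {φ : MLPreFormula n}
    (h : φ.IsExistential) (hw : φ.WellFormed) {ε : ℝ} (hε : 0 < ε) :
    ∃ δ > 0, ∀ (M : MLStructure) [Finite M.carrier] (f : Embedding M N) (v : Fin n → N.carrier)
      (w : Fin n → M.carrier), dist v (f.toFun ∘ w) < δ →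
      (N.eval φ v : ℝ) ≤ M.eval φ w + ε := by
  induction h with
  | quantifierFree h =>
    obtain ⟨δ, hδ, hd⟩ := Metric.uniformContinuous_iff.1 (N.uniformContinuous_eval h hw) ε hε
    refine ⟨δ, hδ, fun M _ f v w hvw => ?_⟩
    have h1 := hd hvw
    rw [f.eval_map h, Subtype.dist_eq, Real.dist_eq] at h1
    linarith [(abs_lt.1 h1).2]
  | @inf _ φ' h ih =>
    rw [MLPreFormula.WellFormed] at hw
    obtain ⟨δ, hδ, hd⟩ := ih hw
    refine ⟨δ, hδ, fun M _ f v w hvw => ?_⟩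
    have : Nonempty M.carrier := ⟨M.zero⟩
    -- Finiteness of `M` yields an exact minimiser, so no additional error arises at each infimum.
    -- Its image is a candidate in `N`; further elements of `N` can only lower the infimum there.
    obtain ⟨a, ha⟩ := exists_eq_ciInf_of_finite (f := fun a => M.eval φ' (Fin.snoc w a))
    have h1 : N.eval (MLPreFormula.inf φ') v ≤ N.eval φ' (Fin.snoc v (f.toFun a)) := by
      rw [eval]
      exact iInf_le _ (f.toFun a)
    have h2 := hd M f (Fin.snoc v (f.toFun a)) (Fin.snoc w a) (by
      rw [Fin.comp_snoc]
      exact dist_snoc_lt _ hδ hvw)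
    have h3 : M.eval (MLPreFormula.inf φ') w = M.eval φ' (Fin.snoc w a) := by
      rw [eval]
      exact ha.symm
    rw [h3]
    exact (Subtype.coe_le_coe.2 h1).trans h2

/-- If every finite tuple of `N` is approximated by tuples in finite embedded structures in
which an `∀∃` formula vanishes identically, then the formula vanishes identically in `N`. -/
theorem eval_eq_zero_of_isForallExists (N : MLStructure) {I : Type} (M : I → MLStructure)
    [∀ i, Finite (M i).carrier] (f : ∀ i, Embedding (M i) N)
    (hdense : ∀ (n : ℕ) (v : Fin n → N.carrier) (δ : ℝ), 0 < δ →
      ∃ (i : I) (w : Fin n → (M i).carrier), dist v ((f i).toFun ∘ w) < δ)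
    {n : ℕ} {φ : MLPreFormula n} (h : φ.IsForallExists) (hw : φ.WellFormed)
    (hM : ∀ i w, (M i).eval φ w = 0) (v : Fin n → N.carrier) : N.eval φ v = 0 := by
  induction h with
  | existential h =>
    refine le_antisymm (Subtype.coe_le_coe.1 ?_) (N.eval _ v).2.1
    refine le_of_forall_pos_le_add fun ε hε => ?_
    -- The order matters: δ depends on `N`, the formula and ε only, so it is available before the
    -- approximating structure is chosen.
    obtain ⟨δ, hδ, hd⟩ := N.eval_le_of_isExistential h hw hε
    obtain ⟨i, w, hvw⟩ := hdense _ v δ hδ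
    simpa [hM i w] using hd (M i) (f i) v w hvw
  | sup h ih =>
    rw [MLPreFormula.WellFormed] at hw
    -- A supremum of nonnegative values that vanishes at all tuples has a body vanishing at all
    -- longer tuples. Hence the induction runs over formulas with free variables that vanish
    -- identically, not over sentences.
    have h0 : ∀ v', N.eval _ v' = 0 := ih hw fun i w => by
      have h1 := hM i (Fin.init w)
      rw [eval] at h1
      refine le_antisymm ?_ ((M i).eval _ w).2.1
      conv_lhs => rw [← Fin.snoc_init_self w]
      exact (le_iSup _ (w (Fin.last _))).trans h1.le
    have : Nonempty N.carrier := ⟨N.zero⟩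
    rw [eval]
    simp only [h0]
    exact iSup_const

end MLStructure

/-! ### The maps φ_n^m preserve 0 and 1 -/

namespace PiLattice

/-- Counting blocks is enough: `numBlocks_phi` gives k(n + 1) + 1 - k = m + 1 blocks, and a
partition with as many blocks as `⊥` equals it. The argument for `⊤` is the same, with one block. -/
theorem phi_bot {n m k : ℕ} (hk : 0 < k) (hm : k * n = m) :
    phi k hk hm (⊥ : PiLattice n) = ⊥ := by
  refine (PartitionLattice.eq_of_le_of_numBlocks bot_le ?_).symm
  have h := numBlocks_phi hk hm (⊥ : PiLattice n)
  rw [PartitionLattice.numBlocks_bot, Nat.card_fin] at h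
  rw [PartitionLattice.numBlocks_bot, Nat.card_fin]
  rw [mul_add, hm] at h
  omega

theorem phi_top {n m k : ℕ} (hk : 0 < k) (hm : k * n = m) :
    phi k hk hm (⊤ : PiLattice n) = ⊤ := by
  refine PartitionLattice.eq_of_le_of_numBlocks le_top ?_
  have h := numBlocks_phi hk hm (⊤ : PiLattice n)
  rw [PartitionLattice.numBlocks_top] at h ⊢
  omega

end PiLattice

/-! ### Constants and finite tuples in the direct limit -/

namespace PiLimit

theorem of_phiHom {n m : DivIndex} (h : n ≤ m) (x : PiLattice n.val) :
    of m (phiHom n m h x) = of n x :=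
  (DirectLimit.eq_of_le (f := phiHom) (⟨n, x⟩ : Σ n : DivIndex, PiLattice n.val) m h).symm

theorem one_le (n : DivIndex) : (⟨1, one_pos⟩ : DivIndex) ≤ n := one_dvd n.val

/-- The constants of the limit are taken at level 1, which divides every level, and the transition
maps carry them along. -/
theorem of_bot (n : DivIndex) : of n ⊥ = zero := by
  rw [zero, ← of_phiHom (one_le n)]
  exact congrArg (of n) (PiLattice.phi_bot (DivIndex.quot_pos (one_le n)) (DivIndex.quot_mul (one_le n))).symm

theorem of_top (n : DivIndex) : of n ⊤ = one := by
  rw [one, ← of_phiHom (one_le n)]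
  exact congrArg (of n) (PiLattice.phi_top (DivIndex.quot_pos (one_le n)) (DivIndex.quot_mul (one_le n))).symm

/-- Finitely many levels have a common multiple, to which all representatives can be pushed. -/
theorem exists_of_tuple {ι : Type} [Finite ι] (z : ι → PiLimit) :
    ∃ (n : DivIndex) (w : ι → PiLattice n.val), ∀ i, of n (w i) = z i := by
  have h : ∀ i, ∃ (n : DivIndex) (x : PiLattice n.val), z i = of n x := fun i => by
    obtain ⟨n, x, _, hx, _⟩ := exists_of₂ (z i) (z i)
    exact ⟨n, x, hx⟩
  choose n x hx using h
  obtain ⟨m, hm⟩ := Finite.exists_le n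
  exact ⟨m, fun i => phiHom (n i) m (hm i) (x i), fun i => by rw [of_phiHom, hx]⟩

end PiLimit

/-! ### The lattices Π_n inside Π_∞, and the conclusion -/

open UniformSpace

/-- The embedding of `Π_n` in `Π_∞`. -/
noncomputable def piEmbedding (n : DivIndex) :
    MLStructure.Embedding (partitionStructure (Fin (n.val + 1))) PiInfinity where
  toFun x := (PiLimit.of n x : Completion PiLimit)
  dist_map x y := (Completion.dist_eq _ _).trans (PiLimit.dist_of n x y)
  map_zero := congrArg ((↑) : PiLimit → Completion PiLimit) (PiLimit.of_bot n)
  map_one := congrArg ((↑) : PiLimit → Completion PiLimit) (PiLimit.of_top n)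
  map_add x y := by
    -- The extended join restricts to the original one on the dense part because that join is
    -- uniformly continuous.
    refine Eq.trans ?_ (Completion.map₂_coe_coe _ _ _ PiLimit.uniformContinuous_join).symm
    exact congrArg ((↑) : PiLimit → Completion PiLimit) (PiLimit.join_of n x y).symm

theorem PartitionLattice.finite (E : Type) [Finite E] : Finite (PartitionLattice E) :=
  Finite.of_injective (fun x : PartitionLattice E => x.Rel) fun _ _ h =>
    PartitionLattice.ext fun a b => iff_of_eq (congrFun (congrFun h a) b)

theorem exists_dist_piEmbedding_lt (k : ℕ) (v : Fin k → PiInfinity.carrier) (δ : ℝ) (hδ : 0 < δ) :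
    ∃ (n : DivIndex) (w : Fin k → (partitionStructure (Fin (n.val + 1))).carrier),
      dist v ((piEmbedding n).toFun ∘ w) < δ := by
  -- Approximate each coordinate separately by density; only afterwards are the approximants brought
  -- to one level.
  have h : ∀ i, ∃ z : PiLimit, dist (v i) (z : Completion PiLimit) < δ := fun i =>
    Completion.denseRange_coe.exists_dist_lt (v i) hδ
  choose z hz using h
  obtain ⟨n, w, hw⟩ := PiLimit.exists_of_tuple z
  refine ⟨n, w, (dist_pi_lt_iff hδ).2 fun i => ?_⟩
  have e : (piEmbedding n).toFun (w i) = (z i : Completion PiLimit) :=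
    congrArg ((↑) : PiLimit → Completion PiLimit) (hw i)
  exact (congrArg (dist (v i)) e).trans_lt (hz i)

theorem mainTheorem11 (σ : MLSentence) (hAE : σ.IsForallExists) (hσ : σ ∈ TFPL) :
    PiInfinity.Satisfies σ := by
  have hfin : ∀ n : DivIndex, Finite (partitionStructure (Fin (n.val + 1))).carrier :=
    fun n => PartitionLattice.finite (Fin (n.val + 1))
  refine PiInfinity.eval_eq_zero_of_isForallExists _ piEmbedding exists_dist_piEmbedding_lt
    hAE σ.2 (fun n w => ?_) _
  -- The only tuple of length zero is the empty one, so vanishing at all tuples is just the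
  -- vanishing of the sentence.
  rw [Subsingleton.elim w Fin.elim0]
  -- Index shift: Π_n lives on {0, …, n}, which has n + 1 ≥ 2 points.
  exact hσ (n.val + 1)
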